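/- For every integer $d \ge 3$, every real $0 < \varepsilon < 1$ and every integer $k \ge 0$, there exist a finite family $F$ of convex sets in $\mathbb{R}^d$ and a non-empty finite set $L$ of lines in general position in $\mathbb{R}^d$ such that 1. every member $K \in F$ intersects at least $\varepsilon |L|$ of the lines in $L$; 2. every set of at most $k$ lines in $\mathbb{R}^d$ misses at least one member of $F$, that is, some $K \in F$ is disjoint from all of these lines. Consequently there are no weak $\varepsilon$-nets of constant size for lines and convex sets: for $d \ge 3$ and $0 < \varepsilon < 1$ there is no integer $k$ such that for every non-empty finite set $L$ of lines in $\mathbb{R}^d$ there is a set $T$ of at most $k$ lines in $\mathbb{R}^d$ such that every convex set that intersects at least $\varepsilon |L|$ lines of $L$ is intersected by a line of $T$. Here a finite set $L$ of lines in $\mathbb{R}^d$ is in general position if, for every $j \ge 1$, the directions of any $j$ of the lines span a linear subspace of dimension $\min(j, d)$, any $j$ of the lines span an affine subspace of dimension $\min(2j-1, d)$ (so for $d \ge 3$ the lines are pairwise skew), and the lines are generic: they can be written as $\{p_\ell + t v_\ell : t \in \mathbb{R}\}$, $\ell \in L$, so that the coordinates of all the points $p_\ell$ and vectors $v_\ell$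 together are algebraically independent over $\mathbb{Q}$. -/

import Mathlib

/-- The Euclidean space of dimension `d`. -/
abbrev Space (d : ℕ) : Type := EuclideanSpace ℝ (Fin d)

/-- A line: an affine subspace of dimension one (the empty subspace has direction `0`,
so it is not a line). -/
def IsLine {d : ℕ} (l : AffineSubspace ℝ (Space d)) : Prop :=
  Module.finrank ℝ l.direction = 1

/-- The line `l` intersects the set `K`. -/
def Meets {d : ℕ} (l : AffineSubspace ℝ (Space d)) (K : Set (Space d)) : Prop :=
  ((l : Set (Space d)) ∩ K).Nonempty

/-- The number of members of the finite set `L` that intersect `K`. -/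
noncomputable def numMeeting {d : ℕ} (L : Finset (AffineSubspace ℝ (Space d)))
    (K : Set (Space d)) : ℕ :=
  Set.ncard {l : AffineSubspace ℝ (Space d) | l ∈ L ∧ Meets l K}

/-- A finite set of lines of `ℝ^d` in general position.

* The directions of any `j` of the lines span a subspace of the largest possible dimension
  `min j d`; so no two are parallel, no three are parallel to a common plane (if `3 ≤ d`), and
  so on.
* Any `j ≥ 1` of the lines span a flat of the largest possible dimension `min (2j - 1) d`; so
  (if `3 ≤ d`) any two are skew.
* The lines are generic: they can be written as `{p l + t • v l}` with all the coordinates of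
  all the `p l` and `v l` algebraically independent over `ℚ`. So the coordinates satisfy no
  nontrivial polynomial relation with rational coefficients, which excludes every further
  algebraic degeneracy (four lines on a regulus, five lines with a common transversal in space,
  and so on). -/
structure LinesInGeneralPosition {d : ℕ} (L : Finset (AffineSubspace ℝ (Space d))) : Prop where
  isLine : ∀ l ∈ L, IsLine l
  finrank_directions : ∀ S ⊆ L,
    Module.finrank ℝ (⨆ l ∈ S, l.direction : Submodule ℝ (Space d)) = min S.card d
  finrank_span : ∀ S ⊆ L, S.Nonempty →
    Module.finrank ℝ (⨆ l ∈ S, l : AffineSubspace ℝ (Space d)).direction =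
      min (2 * S.card - 1) d
  generic : ∃ p v : {l // l ∈ L} → Space d,
    (∀ l, l.1 = AffineSubspace.mk' (p l) (Submodule.span ℝ {v l})) ∧
    AlgebraicIndependent ℚ
      (Sum.elim (fun x => p x.1 x.2) (fun x => v x.1 x.2) :
        ({l // l ∈ L} × Fin d) ⊕ ({l // l ∈ L} × Fin d) → ℝ)

/-- `T` is a weak `ε`-net for the lines `L` and convex sets: a finite set of lines, not
necessarily from `L`, such that every convex set that intersects at least `ε |L|` of the lines
of `L` is intersected by a line of `T`. -/
def IsWeakNet {d : ℕ} (ε : ℝ) (L T : Finset (AffineSubspace ℝ (Space d))) : Prop :=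
  (∀ l ∈ T, IsLine l) ∧
  ∀ K : Set (Space d), Convex ℝ K → ε * (L.card : ℝ) ≤ (numMeeting L K : ℝ) →
    ∃ l ∈ T, Meets l K

/-!
The construction lives on the hyperbolic paraboloid `z = x y` in the space of the first three
coordinates. Before a perturbation, `L` consists of the `n` ruling lines `x = a`, `z = a y` with
`a = 0, …, n - 1`, where `n` is so large that any `n - k` of them are at least `ε n`. For parameters
`t`, `s` and a set `D` of at least `n - k` of the values `a`, the plane `y = t + s x` cuts the
paraboloid in a parabola, and the convex polygon inscribed in that parabola with vertices over
`a ∈ D` meets all the lines of `L` with `a ∈ D`.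

Any `k` lines miss one of these polygons (`exists_inscribedPolygon_missed`). A line that is not
itself of the form `x = c`, `z = c y` meets only finitely many of the lines `y = t`, `z = t x` of
the other ruling (`finite_crossings_or_ruling`). So for some `t` all such lines among the given
ones avoid the line `y = t`, `z = t x`, and they avoid the polygons that belong to `t` and a small
`s > 0`, since these are close to a segment of that line. The remaining lines `x = c`, `z = c y`
meet the plane `y = t + s x` in one point of the parabola; by strict convexity, that point lies
outside the polygon as soon as `c` is left out of `D` (`inscribedPolygon_disjoint_ruling`), and at
most `k` values have to be left out.

A polygon that is missed has a positive distance to the lines, so it may be replaced by a closed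
neighbourhood of small radius. As lines that meet a ball form a compact space, finitely many of
these neighbourhoods suffice for all choices of `k` lines (`exists_finite_subfamily_missed`). This
leaves room to move the lines of `L` slightly. Algebraically independent tuples are dense
(`dense_setOf_algebraicIndependent`), and lines with algebraically independent coordinates are in
general position (`lineThrough_generic`), because a polynomial with rational coefficients that is
nonzero at one rational point is nonzero at an algebraically independent one.
-/

open Filter Topology Metric

/-! ### Algebraically independent coordinates -/

/-- A transcendence basis of `ℝ` over `ℚ` is infinite, and adding rational numbers to the members of
an algebraically independent family keeps it algebraically independent. -/
theorem dense_setOf_algebraicIndependent (σ : Type*) [Finite σ] :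
    Dense {x : σ → ℝ | AlgebraicIndependent ℚ x} := by
  have := Fintype.ofFinite σ
  obtain ⟨ι, b, hb⟩ := exists_isTranscendenceBasis' ℚ ℝ
  have hι : Infinite ι := by
    by_contra h
    have : Finite ι := not_infinite_iff_finite.mp h
    have hcount : Cardinal.mk ℝ ≤ Cardinal.aleph0 := by
      let K := Algebra.adjoin ℚ (Set.range b)
      have : Algebra.IsAlgebraic K ℝ := hb.isAlgebraic
      have hK : Cardinal.mk K ≤ Cardinal.aleph0 := by
        rw [← Cardinal.mk_congr hb.1.aevalEquiv.toEquiv]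
        exact MvPolynomial.cardinalMk_le_max.trans
          (max_le (max_le Cardinal.mk_le_aleph0 Cardinal.mk_le_aleph0) le_rfl)
      exact (Algebra.IsAlgebraic.cardinalMk_le_max K ℝ).trans (max_le hK le_rfl)
    rw [Cardinal.mk_real] at hcount
    exact absurd hcount (not_le.mpr Cardinal.aleph0_lt_continuum)
  obtain ⟨e⟩ : Nonempty (σ ↪ ι) := ⟨(Fintype.equivFin σ).toEmbedding.trans
    (Fin.valEmbedding.trans (Infinite.natEmbedding ι))⟩
  rw [Metric.dense_iff]
  intro z r hr
  have hc : ∀ i, ∃ c : ℚ, |b (e i) + c - z i| < r := by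
    intro i
    obtain ⟨c, h1, h2⟩ := exists_rat_btwn
      (show z i - b (e i) - r < z i - b (e i) + r by linarith)
    exact ⟨c, abs_lt.mpr ⟨by linarith, by linarith⟩⟩
  choose c hc using hc
  refine ⟨fun i => b (e i) + c i, ?_, ?_⟩
  · rw [Metric.mem_ball, dist_pi_lt_iff hr]
    exact fun i => by simpa [Real.dist_eq] using hc i
  · have h := (hb.1.comp e e.injective).polynomial_aeval_of_transcendental
      (f := fun i => Polynomial.X + Polynomial.C (c i)) fun i =>
        Polynomial.transcendental _ (by simp)
          (by simp [Polynomial.leadingCoeff_X_add_C])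
    simpa using h

theorem linearIndependent_of_det_mul_transpose_ne_zero {m n : Type*} [Fintype m] [DecidableEq m]
    [Fintype n] (M : Matrix m n ℝ) (h : (M * M.transpose).det ≠ 0) :
    LinearIndependent ℝ M.row := by
  rw [← Matrix.vecMul_injective_iff]
  have hinj := Matrix.vecMul_injective_of_isUnit
    ((Matrix.isUnit_iff_isUnit_det _).mpr (isUnit_iff_ne_zero.mpr h))
  intro x y hxy
  apply hinj
  simp only [← Matrix.vecMul_vecMul]
  exact congrArg (fun w => Matrix.vecMul w M.transpose) hxy

/-- Vectors whose coordinates are polynomials in algebraically independent numbers span a subspace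
of the largest possible dimension if the polynomials can take arbitrary values simultaneously. The
reason is that the Gram determinant of any `min (card ι) d` of the vectors is a polynomial that
takes the value `1` where the vectors specialize to distinct vectors of the standard basis. -/
theorem finrank_span_of_algebraicIndependent {σ ι : Type*} [Fintype ι] {d : ℕ} {x : σ → ℝ}
    (hx : AlgebraicIndependent ℚ x) (W : ι → Fin d → MvPolynomial σ ℚ)
    (hW : ∀ u : ι → Fin d → ℚ, ∃ y : σ → ℚ, ∀ i c, MvPolynomial.eval y (W i c) = u i c)
    (w : ι → Space d) (hw : ∀ i c, w i c = MvPolynomial.aeval x (W i c)) :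
    Module.finrank ℝ (Submodule.span ℝ (Set.range w)) = min (Fintype.card ι) d := by
  classical
  apply le_antisymm
  · exact le_min (finrank_range_le_card w)
      ((Submodule.finrank_le _).trans_eq (finrank_euclideanSpace_fin))
  obtain ⟨g⟩ : Nonempty (Fin (min (Fintype.card ι) d) ↪ ι) :=
    ⟨(Fin.castLEEmb (min_le_left _ _)).trans (Fintype.equivFin ι).symm.toEmbedding⟩
  have hd : min (Fintype.card ι) d ≤ d := min_le_right _ _
  generalize min (Fintype.card ι) d = m at g hd
  obtain ⟨y, hy⟩ := hW fun i c => if ∃ j, g j = i ∧ Fin.castLE hd j = c then 1 else 0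
  have hyg : ∀ j c, MvPolynomial.eval y (W (g j) c) = if Fin.castLE hd j = c then 1 else 0 := by
    intro j c
    rw [hy]
    congr 1
    simp [g.injective.eq_iff]
  let P : Matrix (Fin m) (Fin d) (MvPolynomial σ ℚ) := Matrix.of fun j c => W (g j) c
  have hP : (P * P.transpose).det ≠ 0 := by
    intro h0
    have h1 := congrArg (MvPolynomial.eval y) h0
    rw [RingHom.map_det, map_zero] at h1
    have h2 : (MvPolynomial.eval y).mapMatrix (P * P.transpose) = 1 := by
      ext a b
      simp [P, Matrix.mul_apply, hyg, Matrix.one_apply, (Fin.castLE_injective hd).eq_iff, eq_comm]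
    rw [h2, Matrix.det_one] at h1
    exact one_ne_zero h1
  have hM : ((Matrix.of fun j c => w (g j) c) *
      (Matrix.of fun j c => w (g j) c : Matrix (Fin m) (Fin d) ℝ).transpose).det ≠ 0 := by
    intro h0
    apply hP
    apply hx
    rw [map_zero, AlgHom.map_det, ← h0]
    congr 1
    ext a b
    simp [P, Matrix.mul_apply, hw]
  have hli : LinearIndependent ℝ (fun j => w (g j)) := by
    have h := linearIndependent_of_det_mul_transpose_ne_zero _ hM
    exact LinearIndependent.of_comp (WithLp.linearEquiv 2 ℝ (Fin d → ℝ)).toLinearMap h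
  calc m = Module.finrank ℝ (Submodule.span ℝ (Set.range fun j => w (g j))) := by
        rw [finrank_span_eq_card hli, Fintype.card_fin]
    _ ≤ _ := Submodule.finrank_mono (Submodule.span_mono (by
        rintro _ ⟨j, rfl⟩; exact ⟨g j, rfl⟩))

/-- The line through `p` in direction `v`, which is a point if `v = 0`. -/
noncomputable def lineThrough {d : ℕ} (p v : Space d) : AffineSubspace ℝ (Space d) :=
  AffineSubspace.mk' p (Submodule.span ℝ {v})

theorem mem_lineThrough {d : ℕ} {p v x : Space d} :
    x ∈ lineThrough p v ↔ ∃ τ : ℝ, p + τ • v = x := by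
  rw [lineThrough, AffineSubspace.mem_mk', Submodule.mem_span_singleton]
  refine exists_congr fun τ => ?_
  rw [vsub_eq_sub, eq_sub_iff_add_eq, add_comm]

/-- Lines with algebraically independent coordinates are pairwise distinct and in general position.
The finite set `L` is described by its members, so that no decidable equality of affine subspaces
enters the statement. -/
theorem lineThrough_generic {d n : ℕ} (hd : 2 ≤ d) (p v : Fin n → Space d)
    (hpv : AlgebraicIndependent ℚ (Sum.elim (fun x => p x.1 x.2) (fun x => v x.1 x.2) :
        (Fin n × Fin d) ⊕ (Fin n × Fin d) → ℝ)) :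
    Function.Injective (fun a => lineThrough (p a) (v a)) ∧
    ∀ L : Finset (AffineSubspace ℝ (Space d)),
      (∀ l, l ∈ L ↔ ∃ a, lineThrough (p a) (v a) = l) → LinesInGeneralPosition L := by
  classical
  have hrank : ∀ s : Finset (Fin n),
      Module.finrank ℝ (Submodule.span ℝ (Set.range fun a : s => v a)) = min s.card d := by
    intro s
    have h := finrank_span_of_algebraicIndependent hpv
      (fun (a : s) c => MvPolynomial.X (Sum.inr (a.1, c)))
      (fun u => ⟨Sum.elim 0 (fun x => if h : x.1 ∈ s then u ⟨x.1, h⟩ x.2 else 0),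
        fun i c => by simp⟩) (fun a => v a) (fun i c => by simp)
    rwa [Fintype.card_coe] at h
  -- The affine span of the lines has the direction spanned by all `v a` and all `p a - p a₀`.
  have hrank2 : ∀ s : Finset (Fin n), ∀ a₀ ∈ s,
      Module.finrank ℝ (Submodule.span ℝ (Set.range
        (Sum.elim (fun a : s => v a) (fun a : (s.erase a₀ : Finset _) => p a - p a₀)))) =
          min (2 * s.card - 1) d := by
    intro s a₀ ha₀
    have h := finrank_span_of_algebraicIndependent hpv
      (Sum.elim (fun (a : s) c => MvPolynomial.X (Sum.inr (a.1, c)))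
        (fun (a : (s.erase a₀ : Finset _)) c =>
          MvPolynomial.X (Sum.inl (a.1, c)) - MvPolynomial.X (Sum.inl (a₀, c))))
      (fun u => ⟨Sum.elim
        (fun x => if h : x.1 ∈ s.erase a₀ then u (Sum.inr ⟨x.1, h⟩) x.2 else 0)
        (fun x => if h : x.1 ∈ s then u (Sum.inl ⟨x.1, h⟩) x.2 else 0), ?_⟩)
      (Sum.elim (fun a : s => v a) (fun a : (s.erase a₀ : Finset _) => p a - p a₀)) ?_
    · rw [h, Fintype.card_sum, Fintype.card_coe, Fintype.card_coe, Finset.card_erase_of_mem ha₀]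
      have := Finset.card_pos.mpr ⟨a₀, ha₀⟩
      congr 1
      omega
    · rintro (⟨i, hi⟩ | ⟨i, hi⟩) c
      · simp [hi]
      · simp only [Sum.elim_inr, map_sub, MvPolynomial.eval_X, Sum.elim_inl, dif_pos hi]
        simp
    · rintro (i | i) c <;> simp
  have hdir : ∀ a, (lineThrough (p a) (v a)).direction = Submodule.span ℝ {v a} :=
    fun a => AffineSubspace.direction_mk' _ _
  have hinj : Function.Injective (fun a => lineThrough (p a) (v a)) := by
    intro a b hab
    by_contra hne
    have h := hrank {a, b}
    rw [Finset.card_pair hne, min_eq_left hd] at h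
    have hsp : Submodule.span ℝ {v b} = Submodule.span ℝ {v a} := by
      rw [← hdir a, ← hdir b]; exact congrArg _ hab.symm
    have hle : Submodule.span ℝ (Set.range fun x : ({a, b} : Finset (Fin n)) => v x) ≤
        Submodule.span ℝ {v a} := by
      rw [Submodule.span_le]
      rintro _ ⟨⟨x, hx⟩, rfl⟩
      rcases Finset.mem_insert.mp hx with rfl | hx
      · exact Submodule.mem_span_singleton_self _
      · obtain rfl := Finset.mem_singleton.mp hx
        exact hsp ▸ Submodule.mem_span_singleton_self (v x)
    have h1 := (Submodule.finrank_mono hle).trans (finrank_span_le_card {v a})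
    rw [Set.toFinset_singleton, Finset.card_singleton] at h1
    omega
  refine ⟨hinj, fun L hL => ?_⟩
  have himage : ∀ S ⊆ L, ∃ s : Finset (Fin n), s.image (fun a => lineThrough (p a) (v a)) = S := by
    intro S hS
    obtain ⟨s, -, hs⟩ := Finset.subset_image_iff.mp
      (show S ⊆ Finset.univ.image (fun a => lineThrough (p a) (v a)) from fun l hl => by
        simpa using (hL l).mp (hS hl))
    exact ⟨s, hs⟩
  refine ⟨?_, ?_, ?_, ?_⟩
  · intro l hl
    obtain ⟨a, rfl⟩ := (hL l).mp hl
    have h := hrank {a}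
    rw [Finset.card_singleton, min_eq_left (by omega)] at h
    have hset : Set.range (fun b : ({a} : Finset (Fin n)) => v b) = {v a} := by
      ext; simp [eq_comm]
    rw [IsLine, hdir, ← h, hset]
  · intro S hS
    obtain ⟨s, rfl⟩ := himage S hS
    rw [Finset.card_image_of_injective _ hinj, ← hrank s]
    have heq : (⨆ l ∈ s.image (fun a => lineThrough (p a) (v a)), l.direction) =
        Submodule.span ℝ (Set.range fun a : s => v a) := by
      rw [Finset.iSup_finset_image]
      simp only [hdir]
      rw [Submodule.span_range_eq_iSup, iSup_subtype]
    rw [heq]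
  · intro S hS hne
    obtain ⟨s, rfl⟩ := himage S hS
    obtain ⟨a₀, ha₀⟩ := Finset.image_nonempty.mp hne
    rw [Finset.card_image_of_injective _ hinj, ← hrank2 s a₀ ha₀]
    rw [Finset.iSup_finset_image]
    have hmem : ∀ a ∈ s, ∀ τ : ℝ, p a + τ • v a ∈ ⨆ a ∈ s, lineThrough (p a) (v a) :=
      fun a ha τ => (le_biSup (fun a => lineThrough (p a) (v a)) ha) (mem_lineThrough.mpr ⟨τ, rfl⟩)
    have hmem0 : ∀ a ∈ s, p a ∈ ⨆ a ∈ s, lineThrough (p a) (v a) := fun a ha => by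
      simpa using hmem a ha 0
    set V := Submodule.span ℝ (Set.range
      (Sum.elim (fun a : s => v a) (fun a : (s.erase a₀ : Finset _) => p a - p a₀))) with hV
    suffices h : (⨆ a ∈ s, lineThrough (p a) (v a)).direction = V by rw [h]
    apply le_antisymm
    · have hle : (⨆ a ∈ s, lineThrough (p a) (v a)) ≤ AffineSubspace.mk' (p a₀) V := by
        refine iSup₂_le fun a ha x hx => ?_
        obtain ⟨τ, rfl⟩ := mem_lineThrough.mp hx
        rw [AffineSubspace.mem_mk', vsub_eq_sub, add_sub_right_comm]
        refine V.add_mem ?_ (V.smul_mem _ (Submodule.subset_span ⟨Sum.inl ⟨a, ha⟩, rfl⟩))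
        by_cases h : a = a₀
        · simp [h]
        · exact Submodule.subset_span ⟨Sum.inr ⟨a, Finset.mem_erase.mpr ⟨h, ha⟩⟩, rfl⟩
      simpa using AffineSubspace.direction_le hle
    · rw [Submodule.span_le]
      rintro _ ⟨⟨a, ha⟩ | ⟨a, ha⟩, rfl⟩
      · simpa using AffineSubspace.vsub_mem_direction (hmem a ha 1) (hmem0 a ha)
      · exact AffineSubspace.vsub_mem_direction (hmem0 a (Finset.mem_of_mem_erase ha))
          (hmem0 a₀ ha₀)
  · choose f hf using fun l : {l // l ∈ L} => (hL l.1).mp l.2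
    have hfinj : Function.Injective f := fun l l' h => Subtype.ext (by rw [← hf l, ← hf l', h])
    refine ⟨fun l => p (f l), fun l => v (f l), fun l => (hf l).symm, ?_⟩
    have h := hpv.comp (Sum.map (Prod.map f id) (Prod.map f id))
      ((hfinj.prodMap Function.injective_id).sumMap (hfinj.prodMap Function.injective_id))
    convert h using 1
    ext (x | x) <;> rfl

/-! ### Polygons inscribed in sections of a hyperbolic paraboloid -/

/-- The point `(a, u, a u, 0, …, 0)` of the hyperbolic paraboloid `z = x y`, which is placed in the
space of the first three coordinates. -/
noncomputable def paraboloidPoint {d : ℕ} (hd : 3 ≤ d) (a u : ℝ) : Space d :=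
  EuclideanSpace.single ⟨0, by omega⟩ a + EuclideanSpace.single ⟨1, by omega⟩ u +
    EuclideanSpace.single ⟨2, by omega⟩ (a * u)

section
variable {d : ℕ} (hd : 3 ≤ d) (a u : ℝ)

@[simp] theorem paraboloidPoint_zero : paraboloidPoint hd a u ⟨0, by omega⟩ = a := by
  simp [paraboloidPoint]

@[simp] theorem paraboloidPoint_one : paraboloidPoint hd a u ⟨1, by omega⟩ = u := by
  simp [paraboloidPoint]

@[simp] theorem paraboloidPoint_two : paraboloidPoint hd a u ⟨2, by omega⟩ = a * u := by
  simp [paraboloidPoint]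

theorem norm_paraboloidPoint_le : ‖paraboloidPoint hd a u‖ ≤ |a| + |u| + |a * u| := by
  refine norm_add₃_le.trans_eq ?_
  simp

theorem continuous_paraboloidPoint : Continuous fun u => paraboloidPoint hd a u := by
  have h (i : Fin d) : Continuous fun x : ℝ => EuclideanSpace.single i x :=
    (Isometry.of_dist_eq fun x y => by simp).continuous
  unfold paraboloidPoint
  exact (continuous_const.add (h _)).add ((h _).comp (continuous_const.mul continuous_id))

end

/-- The convex polygon with the vertices `(a, t + s a, a (t + s a))`, `a ∈ D`, on the parabola in
which the plane `y = t + s x` cuts the paraboloid `z = x y`. It degenerates to a segment of the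
line `y = t`, `z = t x` if `s = 0`. -/
noncomputable def inscribedPolygon {d n : ℕ} (hd : 3 ≤ d) (D : Finset (Fin n)) (t s : ℝ) :
    Set (Space d) :=
  convexHull ℝ ((fun a : Fin n => paraboloidPoint hd a (t + s * a)) '' D)

section
variable {d n : ℕ} (hd : 3 ≤ d) (D : Finset (Fin n)) (t s : ℝ)

theorem isCompact_inscribedPolygon : IsCompact (inscribedPolygon hd D t s) :=
  (D.finite_toSet.image _).isCompact_convexHull ℝ

theorem mem_inscribedPolygon {a : Fin n} (ha : a ∈ D) :
    paraboloidPoint hd a (t + s * a) ∈ inscribedPolygon hd D t s :=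
  subset_convexHull ℝ _ ⟨a, ha, rfl⟩

variable {D t s}

theorem inscribedPolygon_subset {C : Set (Space d)} (hC : Convex ℝ C)
    (h : ∀ a ∈ D, paraboloidPoint hd (a : ℝ) (t + s * a) ∈ C) :
    inscribedPolygon hd D t s ⊆ C := by
  refine convexHull_min ?_ hC
  rintro _ ⟨a, ha, rfl⟩
  exact h a ha

theorem inscribedPolygon_plane {x : Space d} (hx : x ∈ inscribedPolygon hd D t s) :
    x ⟨1, by omega⟩ = t + s * x ⟨0, by omega⟩ := by
  have hC : Convex ℝ {x : Space d | x ⟨1, by omega⟩ = t + s * x ⟨0, by omega⟩} := by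
    intro x hx y hy α β _ _ hαβ
    simp only [Set.mem_ofPred_eq, PiLp.add_apply, PiLp.smul_apply, smul_eq_mul] at *
    rw [hx, hy]
    linear_combination t * hαβ
  exact inscribedPolygon_subset hd hC (by simp) hx

theorem inscribedPolygon_zero {x : Space d} (hx : x ∈ inscribedPolygon hd D t 0) :
    x ⟨2, by omega⟩ = x ⟨0, by omega⟩ * t := by
  have hC : Convex ℝ {x : Space d | x ⟨2, by omega⟩ = x ⟨0, by omega⟩ * t} := by
    intro x hx y hy α β _ _ hαβ
    simp only [Set.mem_ofPred_eq, PiLp.add_apply, PiLp.smul_apply, smul_eq_mul] at *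
    rw [hx, hy]
    ring
  exact inscribedPolygon_subset hd hC (by simp) hx

/-- The ruling line `x = c`, `z = c y` touches the plane `y = t + s x` only in the point of the
parabola over `c`, and the tangent of the parabola there has all other points of the parabola
strictly on one side. -/
theorem inscribedPolygon_disjoint_ruling (hs : 0 < s) {c : ℝ} (hc : ∀ a ∈ D, (a : ℝ) ≠ c)
    {x : Space d} (hx : x ∈ inscribedPolygon hd D t s) (h0 : x ⟨0, by omega⟩ = c) :
    x ⟨2, by omega⟩ ≠ c * x ⟨1, by omega⟩ := by
  have hC : Convex ℝ {x : Space d |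
      0 < x ⟨2, by omega⟩ - (t + 2 * s * c) * x ⟨0, by omega⟩ + s * c ^ 2} := by
    intro x hx y hy α β hα hβ hαβ
    simp only [Set.mem_ofPred_eq, PiLp.add_apply, PiLp.smul_apply, smul_eq_mul] at *
    have h : 0 < α * (x ⟨2, by omega⟩ - (t + 2 * s * c) * x ⟨0, by omega⟩ + s * c ^ 2) +
        β * (y ⟨2, by omega⟩ - (t + 2 * s * c) * y ⟨0, by omega⟩ + s * c ^ 2) := by
      rcases hα.eq_or_lt with rfl | hα'
      · have : β = 1 := by linarith
        subst this
        linarith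
      · have := mul_pos hα' hx
        have := mul_nonneg hβ hy.le
        linarith
    convert h using 1
    linear_combination -s * c ^ 2 * hαβ
  have h : x ∈ {x : Space d |
      0 < x ⟨2, by omega⟩ - (t + 2 * s * c) * x ⟨0, by omega⟩ + s * c ^ 2} := by
    refine inscribedPolygon_subset hd hC (fun a ha => ?_) hx
    have h2 : 0 < s * ((a : ℝ) - c) ^ 2 :=
      mul_pos hs (sq_pos_of_ne_zero (sub_ne_zero.mpr (hc a ha)))
    simp only [Set.mem_ofPred_eq, paraboloidPoint_zero, paraboloidPoint_two]
    linarith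
  intro h2
  have h1 := inscribedPolygon_plane hd hx
  simp only [Set.mem_ofPred_eq, h2, h1, h0] at h
  nlinarith

theorem inscribedPolygon_subset_closedBall (ht : t ∈ Set.Icc (0 : ℝ) 1)
    (hs : s ∈ Set.Icc (0 : ℝ) 1) :
    inscribedPolygon hd D t s ⊆ closedBall 0 (n + (1 + n) + n * (1 + n)) := by
  refine inscribedPolygon_subset hd (convex_closedBall _ _) fun a _ => ?_
  rw [mem_closedBall_zero_iff]
  refine (norm_paraboloidPoint_le hd _ _).trans ?_
  have ha : ((a : ℕ) : ℝ) ≤ n := by exact_mod_cast a.2.le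
  have ha0 : (0 : ℝ) ≤ ((a : ℕ) : ℝ) := Nat.cast_nonneg _
  have hsa : s * ((a : ℕ) : ℝ) ≤ n := (mul_le_of_le_one_left ha0 hs.2).trans ha
  have hu0 : 0 ≤ t + s * ((a : ℕ) : ℝ) := add_nonneg ht.1 (mul_nonneg hs.1 ha0)
  have hu : t + s * ((a : ℕ) : ℝ) ≤ 1 + n := add_le_add ht.2 hsa
  rw [abs_of_nonneg ha0, abs_of_nonneg hu0, abs_of_nonneg (mul_nonneg ha0 hu0)]
  gcongr

end

/-- A line of space either is a ruling line `x = c`, `z = c y` of the paraboloid `z = x y`, or it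
meets only finitely many of the ruling lines `y = t`, `z = t x` of the other family. -/
theorem finite_crossings_or_ruling (p₀ p₁ p₂ v₀ v₁ v₂ : ℝ) :
    {t | ∃ τ : ℝ, p₁ + τ * v₁ = t ∧ p₂ + τ * v₂ = (p₀ + τ * v₀) * t}.Finite ∨
    ∃ c, ∀ τ : ℝ, p₀ + τ * v₀ = c ∧ p₂ + τ * v₂ = c * (p₁ + τ * v₁) := by
  by_cases h1 : v₁ = 0
  · refine Or.inl ((Set.finite_singleton p₁).subset ?_)
    rintro t ⟨τ, rfl, -⟩
    simp [h1]
  let P : Polynomial ℝ := .C (p₂ - p₀ * p₁) + .C (v₂ - p₀ * v₁ - p₁ * v₀) * .X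
    + .C (- (v₀ * v₁)) * .X ^ 2
  by_cases hP : P = 0
  · right
    have hev : ∀ τ : ℝ, (p₂ - p₀ * p₁) + (v₂ - p₀ * v₁ - p₁ * v₀) * τ + -(v₀ * v₁) * τ ^ 2 = 0 := by
      intro τ
      have h := congrArg (Polynomial.eval τ) hP
      simpa only [P, Polynomial.eval_add, Polynomial.eval_mul, Polynomial.eval_C,
        Polynomial.eval_X, Polynomial.eval_pow, Polynomial.eval_zero] using h
    have e0 := hev 0
    have e1 := hev 1
    have e2 := hev (-1)
    have hv : v₀ = 0 := by
      have : v₀ * v₁ = 0 := by linarith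
      exact (mul_eq_zero.mp this).resolve_right h1
    subst hv
    refine ⟨p₀, fun τ => ⟨by ring, ?_⟩⟩
    have := hev τ
    linarith
  · refine Or.inl (((P.roots.toFinset.finite_toSet).image fun τ => p₁ + τ * v₁).subset ?_)
    rintro t ⟨τ, rfl, h⟩
    refine ⟨τ, ?_, rfl⟩
    simp only [Finset.mem_coe, Multiset.mem_toFinset, Polynomial.mem_roots hP, Polynomial.IsRoot,
      P, Polynomial.eval_add, Polynomial.eval_mul, Polynomial.eval_C, Polynomial.eval_X,
      Polynomial.eval_pow]
    linear_combination h

theorem isClosed_lineThrough {d : ℕ} (p v : Space d) :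
    IsClosed (lineThrough p v : Set (Space d)) :=
  AffineSubspace.closed_of_finiteDimensional _

/-- Any `k` lines miss a neighbourhood of an inscribed polygon with at least `n - k` vertices. The
bounds on `t`, `s` and `δ` keep all these neighbourhoods in one ball. -/
theorem exists_inscribedPolygon_missed {d n k : ℕ} (hd : 3 ≤ d) (p v : Fin k → Space d) :
    ∃ (D : Finset (Fin n)) (t s δ : ℝ), n ≤ D.card + k ∧ t ∈ Set.Icc (0 : ℝ) 1 ∧
      s ∈ Set.Icc (0 : ℝ) 1 ∧ δ ∈ Set.Ioc (0 : ℝ) 1 ∧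
      ∀ i, ∀ x ∈ cthickening δ (inscribedPolygon hd D t s), x ∉ lineThrough (p i) (v i) := by
  classical
  -- A line is good if it meets `y = t`, `z = t x` for only finitely many `t`.
  let good : Fin k → Prop := fun i => {t | ∃ τ : ℝ, p i ⟨1, by omega⟩ + τ * v i ⟨1, by omega⟩ = t ∧
    p i ⟨2, by omega⟩ + τ * v i ⟨2, by omega⟩ =
      (p i ⟨0, by omega⟩ + τ * v i ⟨0, by omega⟩) * t}.Finite
  have hbad : ∀ i, ∃ c, ¬ good i → ∀ τ : ℝ, p i ⟨0, by omega⟩ + τ * v i ⟨0, by omega⟩ = c ∧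
      p i ⟨2, by omega⟩ + τ * v i ⟨2, by omega⟩ =
        c * (p i ⟨1, by omega⟩ + τ * v i ⟨1, by omega⟩) := by
    intro i
    by_cases h : good i
    · exact ⟨0, fun h' => absurd h h'⟩
    · obtain ⟨c, hc⟩ := (finite_crossings_or_ruling _ _ _ _ _ _).resolve_left h
      exact ⟨c, fun _ => hc⟩
  choose c hc using hbad
  let D : Finset (Fin n) := Finset.univ.filter fun a => ∀ i, ((a : ℕ) : ℝ) ≠ c i
  have hDc : ∀ i, ∀ a ∈ D, ((a : ℕ) : ℝ) ≠ c i := fun i a ha => (Finset.mem_filter.mp ha).2 i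
  have hD : n ≤ D.card + k := by
    have h1 : (Finset.univ.filter fun a : Fin n => ¬ ∀ i, ((a : ℕ) : ℝ) ≠ c i).card ≤ k := by
      have hinj : Function.Injective fun a : Fin n => ((a : ℕ) : ℝ) :=
        Nat.cast_injective.comp Fin.val_injective
      rw [← Finset.card_image_of_injective _ hinj]
      have hsub : (Finset.univ.filter fun a : Fin n => ¬ ∀ i, ((a : ℕ) : ℝ) ≠ c i).image
          (fun a : Fin n => ((a : ℕ) : ℝ)) ⊆ Finset.univ.image c := by
        intro y hy
        obtain ⟨a, ha, rfl⟩ := Finset.mem_image.mp hy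
        obtain ⟨i, hi⟩ : ∃ i, ((a : ℕ) : ℝ) = c i := by simpa using ha
        exact Finset.mem_image.mpr ⟨i, Finset.mem_univ i, hi.symm⟩
      have h := (Finset.card_le_card hsub).trans Finset.card_image_le
      simpa using h
    have h2 := Finset.card_filter_add_card_filter_not (s := (Finset.univ : Finset (Fin n)))
      (fun a : Fin n => ∀ i, ((a : ℕ) : ℝ) ≠ c i)
    rw [Finset.card_univ, Fintype.card_fin] at h2
    change D.card + _ = n at h2
    omega
  obtain ⟨t, ht, htgood⟩ : ∃ t ∈ Set.Icc (0 : ℝ) 1, ∀ i, good i →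
      ∀ x ∈ inscribedPolygon hd D t 0, x ∉ lineThrough (p i) (v i) := by
    have hfin : (⋃ i ∈ {i | good i}, {t | ∃ τ : ℝ,
        p i ⟨1, by omega⟩ + τ * v i ⟨1, by omega⟩ = t ∧
        p i ⟨2, by omega⟩ + τ * v i ⟨2, by omega⟩ =
          (p i ⟨0, by omega⟩ + τ * v i ⟨0, by omega⟩) * t}).Finite :=
      (Set.toFinite _).biUnion fun i hi => hi
    obtain ⟨t, ht, htn⟩ := (Set.Icc_infinite (zero_lt_one' ℝ)).exists_notMem_finite hfin
    refine ⟨t, ht, fun i hi x hx hxl => htn (Set.mem_biUnion hi ?_)⟩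
    obtain ⟨τ, rfl⟩ := mem_lineThrough.mp hxl
    have h1 := inscribedPolygon_plane hd hx
    have h2 := inscribedPolygon_zero hd hx
    simp only [PiLp.add_apply, PiLp.smul_apply, smul_eq_mul, zero_mul, add_zero] at h1 h2
    exact ⟨τ, h1, h2⟩
  obtain ⟨η, hη, hηU⟩ := (isCompact_inscribedPolygon hd D t 0).exists_cthickening_subset_open
    (isClosed_biUnion_finset (s := Finset.univ.filter good)
      (f := fun i => (lineThrough (p i) (v i) : Set (Space d)))
      fun i _ => isClosed_lineThrough _ _).isOpen_compl
    (fun x hx hx' => by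
      obtain ⟨i, hi, hxi⟩ := Set.mem_iUnion₂.mp hx'
      exact htgood i (Finset.mem_filter.mp hi).2 x hx hxi)
  obtain ⟨s, hs, hsη⟩ : ∃ s ∈ Set.Ioc (0 : ℝ) 1,
      inscribedPolygon hd D t s ⊆ cthickening η (inscribedPolygon hd D t 0) := by
    have hev : ∀ᶠ s in 𝓝 (0 : ℝ), ∀ a : Fin n,
        dist (paraboloidPoint hd a (t + s * a)) (paraboloidPoint hd a (t + 0 * a)) < η := by
      refine eventually_all.mpr fun a => ?_
      have hcont : Continuous fun s : ℝ => paraboloidPoint hd a (t + s * a) :=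
        (continuous_paraboloidPoint hd a).comp (by fun_prop)
      exact hcont.continuousAt.eventually (ball_mem_nhds _ hη)
    obtain ⟨s, hs, hs1⟩ := ((hev.filter_mono nhdsWithin_le_nhds).and
      (Ioc_mem_nhdsGT (zero_lt_one' ℝ))).exists
    exact ⟨s, hs1, inscribedPolygon_subset hd ((convex_convexHull ℝ _).cthickening η) fun a ha =>
      mem_cthickening_of_dist_le _ _ _ _ (mem_inscribedPolygon hd D t 0 ha) (hs a).le⟩
  have hmiss : ∀ i, ∀ x ∈ inscribedPolygon hd D t s, x ∉ lineThrough (p i) (v i) := by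
    intro i x hx hxl
    by_cases hi : good i
    · exact hηU (hsη hx) (Set.mem_biUnion (Finset.mem_filter.mpr ⟨Finset.mem_univ i, hi⟩) hxl)
    · obtain ⟨τ, rfl⟩ := mem_lineThrough.mp hxl
      obtain ⟨h0, h2⟩ := hc i hi τ
      exact inscribedPolygon_disjoint_ruling hd hs.1 (hDc i) hx h0 h2
  obtain ⟨δ, hδ, hδU⟩ := (isCompact_inscribedPolygon hd D t s).exists_cthickening_subset_open
    (isClosed_iUnion_of_finite (s := fun i => (lineThrough (p i) (v i) : Set (Space d)))
      fun i => isClosed_lineThrough _ _).isOpen_compl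
    (fun x hx hx' => by
      obtain ⟨i, hxi⟩ := Set.mem_iUnion.mp hx'
      exact hmiss i x hx hxi)
  refine ⟨D, t, s, min δ 1, hD, ht, ⟨hs.1.le, hs.2⟩, ⟨lt_min hδ one_pos, min_le_right _ _⟩,
    fun i x hx hxl => hδU (cthickening_mono (min_le_left _ _) _ hx) (Set.mem_iUnion.mpr ⟨i, hxl⟩)⟩

/-! ### Compactness and perturbation -/

theorem IsLine.exists_eq_lineThrough {d : ℕ} {l : AffineSubspace ℝ (Space d)} (hl : IsLine l) :
    ∃ v : Space d, ‖v‖ = 1 ∧ ∀ p ∈ l, l = lineThrough p v := by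
  obtain ⟨w, hw0, hw⟩ := finrank_eq_one_iff'.mp hl
  have hw0' : (w : Space d) ≠ 0 := fun h => hw0 (Subtype.ext h)
  have hdir : l.direction = Submodule.span ℝ {(w : Space d)} := by
    apply le_antisymm
    · intro x hx
      obtain ⟨c, hc⟩ := hw ⟨x, hx⟩
      exact Submodule.mem_span_singleton.mpr ⟨c, congrArg Subtype.val hc⟩
    · rw [Submodule.span_singleton_le_iff_mem]
      exact w.2
  refine ⟨‖(w : Space d)‖⁻¹ • (w : Space d), norm_smul_inv_norm hw0', fun p hp => ?_⟩
  rw [lineThrough, Submodule.span_singleton_smul_eq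
    (isUnit_iff_ne_zero.mpr (inv_ne_zero (norm_ne_zero_iff.mpr hw0'))), ← hdir,
    AffineSubspace.mk'_eq hp]

/-- Inside a ball, every line is a segment of bounded length on a line that is given by a point of
the ball and a unit vector; a line that avoids the ball may be represented by any such pair. -/
theorem IsLine.exists_parametrization {d : ℕ} {l : AffineSubspace ℝ (Space d)} (hl : IsLine l)
    {B : ℝ} (hB : 0 ≤ B) :
    ∃ q ∈ closedBall (0 : Space d) B ×ˢ sphere (0 : Space d) 1, ∀ x ∈ l, x ∈ closedBall 0 B →
      ∃ τ ∈ Set.Icc (-(2 * B)) (2 * B), q.1 + τ • q.2 = x := by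
  obtain ⟨v, hv, hlv⟩ := hl.exists_eq_lineThrough
  by_cases h : ∃ p ∈ l, p ∈ closedBall 0 B
  · obtain ⟨p, hp, hpB⟩ := h
    refine ⟨(p, v), ⟨hpB, mem_sphere_zero_iff_norm.mpr hv⟩, fun x hx hxB => ?_⟩
    rw [hlv p hp] at hx
    obtain ⟨τ, rfl⟩ := mem_lineThrough.mp hx
    refine ⟨τ, abs_le.mp ?_, rfl⟩
    calc |τ| = ‖(p + τ • v) - p‖ := by rw [add_sub_cancel_left, norm_smul, hv, mul_one,
          Real.norm_eq_abs]
      _ ≤ ‖p + τ • v‖ + ‖p‖ := norm_sub_le _ _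
      _ ≤ B + B := add_le_add (mem_closedBall_zero_iff.mp hxB) (mem_closedBall_zero_iff.mp hpB)
      _ = 2 * B := by ring
  · exact ⟨(0, v), ⟨by simpa using hB, mem_sphere_zero_iff_norm.mpr hv⟩,
      fun x hx hxB => absurd ⟨x, hx, hxB⟩ h⟩

/-- If any `k` lines miss a member of a uniformly bounded family of closed sets, then finitely many
members of the family suffice. The space of `k`-tuples of lines that meet a large ball is
parametrized by a compact space of pairs of a point and a unit vector, and to miss a given member
is an open condition there. -/
theorem exists_finite_subfamily_missed {d : ℕ} (hd : 0 < d) {J : Type*} (P : J → Prop)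
    (K : J → Set (Space d)) {B : ℝ} (hB : 0 ≤ B) (hKB : ∀ j, P j → K j ⊆ closedBall 0 B)
    (hK : ∀ j, IsClosed (K j)) {k : ℕ}
    (hmiss : ∀ p v : Fin k → Space d, ∃ j, P j ∧ ∀ i, ∀ x ∈ K j, x ∉ lineThrough (p i) (v i)) :
    ∃ J₀ : Finset J, (∀ j ∈ J₀, P j) ∧
      ∀ R : Finset (AffineSubspace ℝ (Space d)), (∀ l ∈ R, IsLine l) → R.card ≤ k →
        ∃ j ∈ J₀, ∀ l ∈ R, ¬ Meets l (K j) := by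
  classical
  choose j hjP hj using fun x : Fin k → Space d × Space d =>
    hmiss (fun i => (x i).1) (fun i => (x i).2)
  let U : (Fin k → Space d × Space d) → Set (Fin k → Space d × Space d) := fun x =>
    {y | ∀ i, ∀ τ ∈ Set.Icc (-(2 * B)) (2 * B), (y i).1 + τ • (y i).2 ∉ K (j x)}
  have hU : ∀ x, U x ∈ 𝓝 x := by
    intro x
    refine eventually_all.mpr fun i => ?_
    refine isCompact_Icc.eventually_forall_of_forall_eventually fun τ _ => ?_
    have hcont : Continuous fun z : (Fin k → Space d × Space d) × ℝ =>
        (z.1 i).1 + z.2 • (z.1 i).2 := by fun_prop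
    exact hcont.continuousAt.eventually
      ((hK (j x)).isOpen_compl.mem_nhds fun h => hj x i _ h (mem_lineThrough.mpr ⟨τ, rfl⟩))
  have hcomp : IsCompact (Set.univ.pi fun _ : Fin k =>
      closedBall (0 : Space d) B ×ˢ sphere (0 : Space d) 1) :=
    isCompact_univ_pi fun _ => (isCompact_closedBall _ _).prod (isCompact_sphere _ _)
  obtain ⟨T, -, hT⟩ := hcomp.elim_nhds_subcover U fun x _ => hU x
  refine ⟨T.image j, ?_, fun R hR hRk => ?_⟩
  · intro i hi
    obtain ⟨x, -, rfl⟩ := Finset.mem_image.mp hi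
    exact hjP x
  choose q hqX hq using fun l : R => (hR l l.2).exists_parametrization hB
  obtain ⟨e⟩ : Nonempty (R ↪ Fin k) := ⟨R.equivFin.toEmbedding.trans (Fin.castLEEmb hRk)⟩
  let y : Fin k → Space d × Space d := Function.extend e q
    fun _ => (0, EuclideanSpace.single ⟨0, hd⟩ 1)
  have hyX : y ∈ Set.univ.pi fun _ : Fin k =>
      closedBall (0 : Space d) B ×ˢ sphere (0 : Space d) 1 := by
    intro i _
    by_cases h : ∃ l, e l = i
    · obtain ⟨l, rfl⟩ := h
      simpa only [y, e.injective.extend_apply] using hqX l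
    · simp only [y, Function.extend_apply' _ _ _ h]
      exact ⟨by simpa using hB, by simp⟩
  obtain ⟨x, hxT, hyx⟩ := Set.mem_iUnion₂.mp (hT hyX)
  refine ⟨j x, Finset.mem_image_of_mem j hxT, fun l hl => ?_⟩
  rintro ⟨z, hzl, hzK⟩
  obtain ⟨τ, hτ, hz⟩ := hq ⟨l, hl⟩ z hzl (hKB _ (hjP x) hzK)
  have h := hyx (e ⟨l, hl⟩) τ hτ
  simp only [y, e.injective.extend_apply, hz] at h
  exact h hzK

/-- The lines through `p a` in direction `v a` can be moved to general position such that the points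
with finitely many prescribed parameters `τ j a` move by less than prescribed distances `δ j`. -/
theorem exists_generic_lines_near {d n : ℕ} (hd : 2 ≤ d) (p v : Fin n → Space d)
    {J : Type*} (J₀ : Finset J) (τ : J → Fin n → ℝ) (δ : J → ℝ) (hδ : ∀ j ∈ J₀, 0 < δ j) :
    ∃ p' v' : Fin n → Space d, Function.Injective (fun a => lineThrough (p' a) (v' a)) ∧
      (∀ L : Finset (AffineSubspace ℝ (Space d)),
        (∀ l, l ∈ L ↔ ∃ a, lineThrough (p' a) (v' a) = l) → LinesInGeneralPosition L) ∧
      ∀ j ∈ J₀, ∀ a, dist (p' a + τ j a • v' a) (p a + τ j a • v a) < δ j := by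
  let P : ((Fin n × Fin d) ⊕ (Fin n × Fin d) → ℝ) → Fin n → Space d :=
    fun x a => WithLp.toLp 2 fun c => x (Sum.inl (a, c))
  let V : ((Fin n × Fin d) ⊕ (Fin n × Fin d) → ℝ) → Fin n → Space d :=
    fun x a => WithLp.toLp 2 fun c => x (Sum.inr (a, c))
  let z : (Fin n × Fin d) ⊕ (Fin n × Fin d) → ℝ :=
    Sum.elim (fun x => p x.1 x.2) (fun x => v x.1 x.2)
  have hev : ∀ᶠ x in 𝓝 z, ∀ j ∈ J₀, ∀ a,
      dist (P x a + τ j a • V x a) (p a + τ j a • v a) < δ j := by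
    refine (eventually_all_finset J₀).mpr fun j hj => eventually_all.mpr fun a => ?_
    have hcont : Continuous fun x => P x a + τ j a • V x a := by
      simp only [P, V]
      fun_prop
    have hz : P z a + τ j a • V z a = p a + τ j a • v a := by
      ext c
      simp [P, V, z]
    exact (hcont.tendsto' z _ hz).eventually (ball_mem_nhds _ (hδ j hj))
  obtain ⟨x, hx, hxnear⟩ := ((mem_closure_iff_frequently.mp
    (dense_setOf_algebraicIndependent _ z)).and_eventually hev).exists
  have hx' : AlgebraicIndependent ℚ
      (Sum.elim (fun y => P x y.1 y.2) (fun y => V x y.1 y.2) :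
        (Fin n × Fin d) ⊕ (Fin n × Fin d) → ℝ) := by
    have h : (Sum.elim (fun y => P x y.1 y.2) (fun y => V x y.1 y.2) :
        (Fin n × Fin d) ⊕ (Fin n × Fin d) → ℝ) = x := by
      ext (_ | _) <;> rfl
    rw [h]
    exact hx
  have hgen := lineThrough_generic hd (P x) (V x) hx'
  exact ⟨P x, V x, hgen.1, hgen.2, hxnear⟩

theorem theorem1 (d : ℕ) (hd : 3 ≤ d) (ε : ℝ) (hε0 : 0 < ε) (hε1 : ε < 1) :
    (∀ k : ℕ, ∃ (F : Finset (Set (Space d))) (L : Finset (AffineSubspace ℝ (Space d))),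
      (∀ K ∈ F, Convex ℝ K) ∧
      L.Nonempty ∧ LinesInGeneralPosition L ∧
      (∀ K ∈ F, ε * (L.card : ℝ) ≤ (numMeeting L K : ℝ)) ∧
      (∀ R : Finset (AffineSubspace ℝ (Space d)), (∀ l ∈ R, IsLine l) → R.card ≤ k →
        ∃ K ∈ F, ∀ l ∈ R, ¬ Meets l K)) ∧
    ¬ ∃ k : ℕ, ∀ L : Finset (AffineSubspace ℝ (Space d)), L.Nonempty → (∀ l ∈ L, IsLine l) →
      ∃ T : Finset (AffineSubspace ℝ (Space d)), T.card ≤ k ∧ IsWeakNet ε L T := by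
  classical
  rw [and_iff_left_of_imp]
  · intro k
    -- With `n` lines, a set that meets all but `k` of them meets at least `ε n`.
    obtain ⟨n, hn⟩ := exists_nat_gt ((k : ℝ) / (1 - ε))
    rw [div_lt_iff₀ (sub_pos.mpr hε1)] at hn
    have hn0 : 0 < n := by
      rcases Nat.eq_zero_or_pos n with rfl | h
      · rw [Nat.cast_zero, zero_mul] at hn
        exact absurd hn (not_lt.mpr (Nat.cast_nonneg k))
      · exact h
    let K : Finset (Fin n) × ℝ × ℝ × ℝ → Set (Space d) := fun j =>
      cthickening j.2.2.2 (inscribedPolygon hd j.1 j.2.1 j.2.2.1)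
    obtain ⟨J₀, hJ₀, hmiss⟩ := exists_finite_subfamily_missed (k := k) (by omega)
      (fun j : Finset (Fin n) × ℝ × ℝ × ℝ => n ≤ j.1.card + k ∧ j.2.1 ∈ Set.Icc (0 : ℝ) 1 ∧
        j.2.2.1 ∈ Set.Icc (0 : ℝ) 1 ∧ j.2.2.2 ∈ Set.Ioc (0 : ℝ) 1) K
      (B := (n + (1 + n) + n * (1 + n)) + 1) (by positivity)
      (fun j hj => by
        refine (cthickening_mono hj.2.2.2.2 _).trans ?_
        refine (cthickening_subset_of_subset _
          (inscribedPolygon_subset_closedBall hd hj.2.1 hj.2.2.1)).trans ?_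
        rw [cthickening_closedBall zero_le_one (by positivity), add_comm])
      (fun j => isClosed_cthickening)
      (fun p v => by
        obtain ⟨D, t, s, δ, hD, ht, hs, hδ, h⟩ := exists_inscribedPolygon_missed (n := n) hd p v
        exact ⟨(D, t, s, δ), ⟨hD, ht, hs, hδ⟩, h⟩)
    -- The unperturbed lines are the ruling lines `x = a`, `z = a y` with `0 ≤ a < n`.
    obtain ⟨p, v, hinj, hgen, hnear⟩ := exists_generic_lines_near (by omega)
      (fun a : Fin n => paraboloidPoint hd a 0)
      (fun a : Fin n => paraboloidPoint hd a 1 - paraboloidPoint hd a 0) J₀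
      (fun j a => j.2.1 + j.2.2.1 * a) (fun j => j.2.2.2) (fun j hj => (hJ₀ j hj).2.2.2.1)
    have hruling : ∀ a u : ℝ, paraboloidPoint hd a 0 +
        u • (paraboloidPoint hd a 1 - paraboloidPoint hd a 0) = paraboloidPoint hd a u := by
      intro a u
      ext i
      simp only [paraboloidPoint, PiLp.add_apply, PiLp.smul_apply, PiLp.sub_apply,
        PiLp.single_apply, smul_eq_mul]
      split_ifs <;> ring
    simp only [hruling] at hnear
    refine ⟨J₀.image K, Finset.univ.image fun a => lineThrough (p a) (v a), ?_, ?_,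
      hgen _ (by simp), ?_, ?_⟩
    · intro C hC
      obtain ⟨j, -, rfl⟩ := Finset.mem_image.mp hC
      exact (convex_convexHull ℝ _).cthickening _
    · exact Finset.image_nonempty.mpr ⟨⟨0, hn0⟩, Finset.mem_univ _⟩
    · intro C hC
      obtain ⟨j, hj, rfl⟩ := Finset.mem_image.mp hC
      rw [Finset.card_image_of_injective _ hinj, Finset.card_univ, Fintype.card_fin]
      have hcard : j.1.card ≤
          numMeeting (Finset.univ.image fun a => lineThrough (p a) (v a)) (K j) := by
        rw [numMeeting, ← Finset.card_image_of_injective j.1 hinj, ← Set.ncard_coe_finset]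
        refine Set.ncard_le_ncard (fun l hl => ?_)
          ((Finset.finite_toSet _).subset fun l hl => Finset.mem_coe.mpr hl.1)
        obtain ⟨a, ha, rfl⟩ := Finset.mem_image.mp (Finset.mem_coe.mp hl)
        exact ⟨Finset.mem_image_of_mem _ (Finset.mem_univ a), _, mem_lineThrough.mpr ⟨_, rfl⟩,
          mem_cthickening_of_dist_le _ _ _ _ (mem_inscribedPolygon hd _ _ _ ha)
            (hnear j hj a).le⟩
      have h1 : (n : ℝ) ≤ j.1.card + k := by exact_mod_cast (hJ₀ j hj).1
      have h2 : (j.1.card : ℝ) ≤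
          numMeeting (Finset.univ.image fun a => lineThrough (p a) (v a)) (K j) := by
        exact_mod_cast hcard
      linarith
    · intro R hR hRk
      obtain ⟨j, hj, h⟩ := hmiss R hR hRk
      exact ⟨K j, Finset.mem_image_of_mem K hj, h⟩
  · rintro h ⟨k, hk⟩
    obtain ⟨F, L, hF, hne, hL, hmeet, hR⟩ := h k
    obtain ⟨T, hTk, hT, hnet⟩ := hk L hne hL.isLine
    obtain ⟨K, hK, hmiss⟩ := hR T hT hTk
    obtain ⟨l, hl, hlK⟩ := hnet K (hF K hK) (hmeet K hK)
    exact hmiss l hl hlK
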